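/- Let $F$ be a field of characteristic $0$, let $H$ be a finite-dimensional associative $F$-algebra with $1$, and let $L$ be a finite-dimensional semisimple Lie algebra over $F$ with a generalized action of $H$, i.e. a unital homomorphism $\rho\colon H\to\operatorname{End}_F(L)$, written $\rho(h)a=ha$, such that for every $h\in H$ there are finitely many $h'_i,h''_i\in H$ with $h[a,b]=\sum_i[h'_ia,h''_ib]$ for all $a,b\in L$. Assume that $L$ is $H$-simple, i.e. $L$ is non-abelian and its only $H$-invariant ideals are $0$ and $L$. Assume moreover that $F$ is algebraically closed or, more generally, that the only $F$-linear maps $L\to L$ commuting with $\rho(H)$ and with $\operatorname{ad}(L)$ are the scalars. Let $l_1,\dots,l_t$ be a basis of $L$, $t=\dim_F L$. For a set $X$ of variables let $L(X\mid H)$ be the free Lie algebra on the symbols $x^{\gamma}$, where $x\in X$ and $\gamma$ runs over a basis of $H$; for $h=\sum_\gamma c_\gamma\gamma\in H$ put $x^h=\sum_\gamma c_\gamma x^{\gamma}$. Its elements are called $H$-polynomials; they are evaluated on $L$ by $x\mapsto a_x$, $x^h\mapsto ha_x$. An $H$-polynomial in $x_1,\dots,x_n$ is multilinear if it is a linear combination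 of left-normed commutators $[x_{\sigma(1)}^{h_1},\dots,x_{\sigma(n)}^{h_n}]$ with $\sigma\in S_n$ and $h_1,\dots,h_n\in H$; it is alternating in a set of variables if every permutation of that set multiplies it by the sign of the permutation. Then there exist an integer $C>0$ and elements $\bar z_1,\dots,\bar z_C\in L$ such that for every $k\ge 0$ there is a multilinear $H$-polynomial $$f=f(x_1^1,\dots,x_t^1;\ \dots;\ x_1^{2k},\dots,x_t^{2k};\ z_1,\dots,z_C;\ z)$$ in these $2kt+C+1$ variables that is alternating in each of the $2k$ sets $\{x_1^j,\dots,x_t^j\}$, $1\le j\le 2k$, and satisfies $$f(l_1,\dots,l_t;\ \dots;\ l_1,\dots,l_t;\ \bar z_1,\dots,\bar z_C;\ \bar z)=\bar z\qquad\text{for every }\bar z\in L.$$ -/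

import Mathlib

noncomputable section

namespace HLie

/-- A generalized action of the unital associative algebra `H` on the Lie algebra `L`: a unital
algebra homomorphism `ρ : H → End_F(L)` such that for every `h` there are `h'ᵢ, h''ᵢ ∈ H` with
`h⁅a, b⁆ = ∑ᵢ ⁅h'ᵢ a, h''ᵢ b⁆` for all `a, b ∈ L`. -/
def IsGeneralizedAction {F H L : Type*} [Field F] [Ring H] [Algebra F H] [LieRing L]
    [LieAlgebra F L] (ρ : H →ₐ[F] Module.End F L) : Prop :=
  ∀ h : H, ∃ (n : ℕ) (h' h'' : Fin n → H), ∀ a b : L,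
    ρ h ⁅a, b⁆ = ∑ i, ⁅ρ (h' i) a, ρ (h'' i) b⁆

/-- `L` is `H`-simple: it is non-abelian and its only `H`-invariant ideals are `0` and `L`. -/
def IsHSimple {F H L : Type*} [Field F] [Ring H] [Algebra F H] [LieRing L]
    [LieAlgebra F L] (ρ : H →ₐ[F] Module.End F L) : Prop :=
  ¬ IsLieAbelian L ∧
    ∀ I : LieIdeal F L, (∀ h : H, ∀ a ∈ I, ρ h a ∈ I) → I = ⊥ ∨ I = ⊤

/-- `L` is `H`-central: the `F`-linear maps `L → L` that commute with the adjoint action and with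
the action of `H` are the scalars. -/
def IsHCentral {F H L : Type*} [Field F] [Ring H] [Algebra F H] [LieRing L]
    [LieAlgebra F L] (ρ : H →ₐ[F] Module.End F L) : Prop :=
  ∀ φ : Module.End F L, (∀ a : L, Commute φ (LieAlgebra.ad F L a)) →
    (∀ h : H, Commute φ (ρ h)) → ∃ c : F, φ = c • (1 : Module.End F L)

/-- Index set of a fixed `F`-basis of `H`. -/
abbrev BasisIndex (F H : Type*) [Field F] [Ring H] [Algebra F H] : Type _ :=
  Module.Basis.ofVectorSpaceIndex F H

/-- The algebra `L(X | H)` of Lie `H`-polynomials in the variables `X`: the free Lie algebra on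
the symbols `x^γ`, where `x ∈ X` and `γ` runs over a fixed basis of `H`. -/
abbrev HPoly (F H X : Type*) [Field F] [Ring H] [Algebra F H] : Type _ :=
  FreeLieAlgebra F (X × BasisIndex F H)

/-- The element `x^h` of `L(X | H)`, linear in `h ∈ H`. -/
def HPoly.var (F : Type*) {H X : Type*} [Field F] [Ring H] [Algebra F H] (x : X) (h : H) :
    HPoly F H X :=
  ((Module.Basis.ofVectorSpace F H).repr h).sum fun γ c => c • FreeLieAlgebra.of F (x, γ)

/-- The value of an `H`-polynomial under the substitution `x ↦ a x`, that is, `x^h ↦ h (a x)`. -/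
def HPoly.eval {F H L X : Type*} [Field F] [Ring H] [Algebra F H] [LieRing L]
    [LieAlgebra F L] (ρ : H →ₐ[F] Module.End F L) (a : X → L) : HPoly F H X →ₗ⁅F⁆ L :=
  FreeLieAlgebra.lift F fun p => ρ (Module.Basis.ofVectorSpace F H p.2) (a p.1)

/-- Renaming of variables: `x^h ↦ (s x)^h`. -/
def HPoly.rename {F H X Y : Type*} [Field F] [Ring H] [Algebra F H] (s : X → Y) :
    HPoly F H X →ₗ⁅F⁆ HPoly F H Y :=
  FreeLieAlgebra.lift F fun p => FreeLieAlgebra.of F (s p.1, p.2)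

/-- The left-normed commutator `[a₁, …, aₙ] = [[a₁, …, aₙ₋₁], aₙ]`. -/
def leftNormed {M : Type*} [LieRing M] : List M → M
  | [] => 0
  | a :: l => l.foldl (fun u v => ⁅u, v⁆) a

/-- The space `V_n^H` of multilinear `H`-polynomials in the variables of the finite set `X`
(`n = |X|`): the span of all `[x_{σ(1)}^{h₁}, …, x_{σ(n)}^{hₙ}]`. -/
def HPoly.multilinear (F H X : Type*) [Field F] [Ring H] [Algebra F H] [Fintype X] :
    Submodule F (HPoly F H X) :=
  Submodule.span F {f | ∃ (e : Fin (Fintype.card X) ≃ X) (h : Fin (Fintype.card X) → H),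
    f = leftNormed (List.ofFn fun i => HPoly.var F (e i) (h i))}

/-- `f` is alternating in the set `S` of variables: every permutation `σ` of the variables in `S`
multiplies `f` by its sign. -/
def HPoly.IsAlternatingIn {F H X : Type*} [Field F] [Ring H] [Algebra F H] [Fintype X]
    [DecidableEq X] (f : HPoly F H X) (S : Set X) : Prop :=
  ∀ σ : Equiv.Perm X, (∀ x, x ∉ S → σ x = x) →
    HPoly.rename σ f = ((Equiv.Perm.sign σ : ℤ) : F) • f

/-- The variables `x_i^j` (`i < t`, `j < m`), `z_1, …, z_C` and `z`. -/
abbrev Var (t m C : ℕ) : Type := (Fin m × Fin t) ⊕ (Fin C ⊕ Unit)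

/-- The `j`-th set of variables `{x_1^j, …, x_t^j}`. -/
def Var.block {t m C : ℕ} (j : Fin m) : Set (Var t m C) :=
  Set.range fun i : Fin t => Sum.inl (j, i)

/-- The substitution `x_i^j ↦ l_i`, `z_i ↦ w_i`, `z ↦ v`. -/
def Var.subst {L : Type*} {t m C : ℕ} (l : Fin t → L) (w : Fin C → L) (v : L) :
    Var t m C → L :=
  Sum.elim (fun p => l p.2) (Sum.elim w fun _ => v)

end HLie

end

/-!
The operators `ad (h a)` and `h` generate `End L` by the density theorem, so any operator is a
combination of values of words in them. Words are closed under composition because `h` can be moved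
to the right past `ad`. They are not closed under multiplication by traces, but once one alternating
block `x₁, …, x_t` is present traces can be absorbed into it, by
`tr φ • det x = ∑ᵢ det (x₁, …, φ xᵢ, …, x_t)`.

A Capelli polynomial in `ad x₁, …, ad x_t` produces a first block, with a coefficient `T` that can
be given non-zero trace. For a basis `X` of `End L` with trace-dual basis `X*` the operator
`∑ₚ Xₚ* T Xₚ` is the scalar `tr T`, and after multiplication by the Gram determinant
`det (tr (Xᵢ Xⱼ))` it is a combination of words with traces as coefficients; hence some multilinear
polynomial with one alternating block takes a non-zero scalar value. Two further blocks `u` and `v`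
are added by multiplying with the Gram determinant of `u` and `v` under the Killing form, which is
itself a polynomial in traces and is proportional to `det u * det v`. Antisymmetrizing turns the
alternation of the values into alternation of the polynomial.
-/

namespace HLie

open Module Function Finset Equiv

section TopDegree

variable {R M N ι : Type*} [CommRing R] [AddCommGroup M] [Module R M] [AddCommGroup N] [Module R N]
  [Fintype ι] [DecidableEq ι]

theorem alternatingMap_apply_eq_det_smul (e : Basis ι R M) (f : M [⋀^ι]→ₗ[R] N) (v : ι → M) :
    f v = e.det v • f e := by
  have h : f = (LinearMap.toSpanSingleton R N (f e)).compAlternatingMap e.det :=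
    e.ext_alternating fun s hs => by
      obtain ⟨σ, rfl⟩ : ∃ σ : Perm ι, s = σ :=
        ⟨Equiv.ofBijective s (Finite.injective_iff_bijective.1 hs), rfl⟩
      change f (e ∘ σ) = e.det (e ∘ σ) • f e
      rw [AlternatingMap.map_perm, AlternatingMap.map_perm, e.det_self]
      simp only [Units.smul_def, smul_assoc, one_smul]
  exact congrArg (· v) h

theorem sum_det_updateCol_mulVec (A B : Matrix ι ι R) :
    ∑ i, (B.updateCol i (A.mulVec (B.col i))).det = A.trace * B.det := by
  calc ∑ i, (B.updateCol i (A.mulVec (B.col i))).det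
      = (B.adjugate * (A * B)).trace := by
        refine Finset.sum_congr rfl fun i _ => ?_
        rw [← Matrix.cramer_apply, Matrix.cramer_eq_adjugate_mulVec]
        rfl
    _ = A.trace * B.det := by
        rw [Matrix.trace_mul_comm, mul_assoc, Matrix.mul_adjugate]
        simp [mul_comm]

theorem sum_alternatingMap_update (e : Basis ι R M) (f : M [⋀^ι]→ₗ[R] N) (φ : End R M)
    (v : ι → M) : ∑ i, f (update v i (φ (v i))) = LinearMap.trace R M φ • f v := by
  have hdet : ∑ i, e.det (update v i (φ (v i))) = LinearMap.trace R M φ * e.det v := by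
    rw [LinearMap.trace_eq_matrix_trace R e, e.det_apply, ← sum_det_updateCol_mulVec]
    refine Finset.sum_congr rfl fun i _ => ?_
    rw [e.det_apply, e.toMatrix_update]
    congr 2
    exact (LinearMap.toMatrix_mulVec_repr e e φ (v i)).symm
  rw [alternatingMap_apply_eq_det_smul e f v, ← mul_smul, ← hdet, Finset.sum_smul]
  exact Finset.sum_congr rfl fun i _ => alternatingMap_apply_eq_det_smul e f _

theorem det_bilinForm_apply (e : Basis ι R M) (B : LinearMap.BilinForm R M) (u v : ι → M) :
    (Matrix.of fun i j => B (u i) (v j)).det =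
      (LinearMap.BilinForm.toMatrix e B).det * (e.det u * e.det v) := by
  have h : (Matrix.of fun i j => B (u i) (v j)) =
      (e.toMatrix u).transpose * LinearMap.BilinForm.toMatrix e B * e.toMatrix v := by
    ext i j
    rw [Matrix.of_apply, LinearMap.BilinForm.apply_eq_dotProduct_toMatrix_mulVec e,
      Matrix.mul_assoc]
    rfl
  rw [h, Matrix.det_mul, Matrix.det_mul, Matrix.det_transpose, e.det_apply, e.det_apply]
  ring

theorem trace_mulLeftRight [Module.Free R M] [Module.Finite R M] (A B : End R M) :
    LinearMap.trace R (End R M) (LinearMap.mulLeftRight R (A, B)) =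
      LinearMap.trace R M A * LinearMap.trace R M B := by
  classical
  let b := Free.chooseBasis R M
  rw [LinearMap.trace_eq_matrix_trace R (b.linearMap b), LinearMap.trace_eq_matrix_trace R b A,
    LinearMap.trace_eq_matrix_trace R b B, Matrix.trace, Matrix.trace, Matrix.trace,
    Finset.sum_mul_sum, Fintype.sum_prod_type]
  refine Finset.sum_congr rfl fun i _ => Finset.sum_congr rfl fun j _ => ?_
  rw [Matrix.diag_apply, LinearMap.toMatrix_apply, Basis.linearMap_repr_apply,
    LinearMap.mulLeftRight_apply, LinearMap.toMatrix_mul, LinearMap.toMatrix_mul,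
    Basis.linearMap_apply, LinearMap.toMatrix_toLin, Matrix.stdBasis_eq_single]
  change (LinearMap.toMatrix b b A * Matrix.single i j 1 * LinearMap.toMatrix b b B :
    Matrix _ _ R) i j = _
  simp [Matrix.mul_apply, Matrix.single_apply, ite_and, Finset.sum_ite_eq]

end TopDegree

section Endomorphisms

variable {F V : Type*} [Field F] [AddCommGroup V] [Module F V]

theorem exists_mem_multilinearMap_apply_ne_zero {ι W : Type*} [Finite ι] [AddCommGroup W]
    [Module F W] {S : Set V} (hS : Submodule.span F S = ⊤)
    {f : MultilinearMap F (fun _ : ι => V) W} (hf : f ≠ 0) :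
    ∃ v : ι → V, (∀ i, v i ∈ S) ∧ f v ≠ 0 := by
  by_contra! h
  refine hf (Basis.ext_multilinear (fun _ => Basis.ofSpan hS.ge) fun s => h _ fun i => ?_)
  exact Basis.ofSpan_subset hS.ge ⟨s i, rfl⟩

theorem exists_dual_apply_eq_one_apply {ι : Type*} [DecidableEq ι] {x : ι → V}
    (hx : LinearIndependent F x) :
    ∃ φ : ι → Dual F V, ∀ i j, φ i (x j) = (1 : Matrix ι ι F) j i := by
  obtain ⟨g, hg⟩ := LinearMap.exists_leftInverse_of_injective _ (LinearMap.ker_eq_bot.2 hx)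
  refine ⟨fun i => Finsupp.lapply i ∘ₗ g, fun i j => ?_⟩
  have hgx : g (x j) = Finsupp.single j 1 := by
    simpa using LinearMap.congr_fun hg (Finsupp.single j 1)
  simp [hgx, Matrix.one_apply, Finsupp.single_apply]

theorem exists_alternatization_prod_ne_zero {A : Type*} [Ring A] [Nontrivial A] [Algebra F A]
    {n : ℕ} {x : Fin n → A} (hx : LinearIndependent F x) {S : Set (End F A)}
    (hS : Submodule.span F S = ⊤) :
    ∃ Ψ : Fin n → End F A, (∀ i, Ψ i ∈ S) ∧
      MultilinearMap.alternatization
        ((MultilinearMap.mkPiAlgebraFin F n A).compLinearMap Ψ) x ≠ 0 := by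
  let f : MultilinearMap F (fun _ : Fin n => End F A) A := ∑ σ : Perm (Fin n),
    Perm.sign σ • (MultilinearMap.mkPiAlgebraFin F n A).compLinearMap
      fun i => LinearMap.applyₗ (x (σ i))
  have hf_apply (Ψ : Fin n → End F A) : f Ψ = MultilinearMap.alternatization
      ((MultilinearMap.mkPiAlgebraFin F n A).compLinearMap Ψ) x := by
    rw [MultilinearMap.alternatization_apply]
    simp [f]
  have hf : f ≠ 0 := by
    obtain ⟨φ, hφ⟩ := exists_dual_apply_eq_one_apply hx
    have hdet : MultilinearMap.alternatization ((MultilinearMap.mkPiAlgebraFin F n A).compLinearMap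
        fun i => (φ i).smulRight 1) x =
          algebraMap F A (Matrix.det (1 : Matrix (Fin n) (Fin n) F)) := by
      rw [MultilinearMap.alternatization_apply, Matrix.det_apply, map_sum]
      refine Finset.sum_congr rfl fun σ _ => ?_
      simp [hφ, Units.smul_def, ← Algebra.algebraMap_eq_smul_one, ← List.prod_ofFn, map_list_prod,
        List.map_ofFn, comp_def]
    intro h0
    simpa [h0, hdet] using hf_apply fun i => (φ i).smulRight 1
  obtain ⟨Ψ, hΨ, hne⟩ := exists_mem_multilinearMap_apply_ne_zero hS hf
  exact ⟨Ψ, hΨ, hf_apply Ψ ▸ hne⟩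

/-- The Capelli polynomial `∑ sgn σ a₁ x_{σ 1} b₁ ⋯ aₙ x_{σ n} bₙ`, alternating in the `xᵢ`. -/
def capelli {A : Type*} [Ring A] {n : ℕ} (a b x : Fin n → A) : A :=
  ∑ σ : Perm (Fin n), Perm.sign σ • (List.ofFn fun i => a i * x (σ i) * b i).prod

theorem capelli_eq_alternatization {R A : Type*} [CommRing R] [Ring A] [Algebra R A] {n : ℕ}
    (a b x : Fin n → A) :
    capelli a b x = MultilinearMap.alternatization
      ((MultilinearMap.mkPiAlgebraFin R n A).compLinearMap
        fun i => LinearMap.mulLeftRight R (a i, b i)) x := by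
  simp [capelli, MultilinearMap.alternatization_apply]

variable [FiniteDimensional F V] {ι : Type*} [Fintype ι] [DecidableEq ι]

theorem eq_of_trace_mul_eq {A B : End F V}
    (h : ∀ Z, LinearMap.trace F V (Z * A) = LinearMap.trace F V (Z * B)) : A = B := by
  let b := Module.finBasis F V
  apply (LinearMap.toMatrix b b).injective
  rw [Matrix.ext_iff_trace_mul_left]
  intro M
  simpa [LinearMap.trace_eq_matrix_trace F b, LinearMap.toMatrix_mul] using h (Matrix.toLin b b M)

theorem det_trace_mul_ne_zero (X : Basis ι F (End F V)) :
    (Matrix.of fun i j => LinearMap.trace F V (X i * X j)).det ≠ 0 := by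
  let B : LinearMap.BilinForm F (End F V) :=
    (LinearMap.mul F (End F V)).compr₂ (LinearMap.trace F V)
  have hsymm : B.IsRefl := fun A C h => (LinearMap.trace_mul_comm F C A).trans h
  have hB : B.Nondegenerate := hsymm.nondegenerate_iff_separatingRight.2 fun A hA =>
    eq_of_trace_mul_eq fun Z => (hA Z).trans (by simp)
  convert (LinearMap.BilinForm.nondegenerate_iff_det_ne_zero X).1 hB
  ext i j
  simp [B]

/-- The Casimir-type operator `∑ₚ Xₚ* T Yₚ`, where `Xₚ*` is `det (tr (Xᵢ Yⱼ))` times the element of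
the span of the `Xᵢ` dual to `Yₚ` under the trace form. Cramer's rule makes it a polynomial in `X`,
`Y` and `T`. -/
noncomputable def gramCasimir (X Y : ι → End F V) (T : End F V) : End F V :=
  ∑ p, ∑ σ : Perm ι, Perm.sign σ •
    (∏ q ∈ univ.erase p, LinearMap.trace F V (X (σ q) * Y q)) • (X (σ p) * T * Y p)

theorem gramCasimir_eq_smul_one (hι : Fintype.card ι = finrank F (End F V)) (X Y : ι → End F V)
    (T : End F V) :
    gramCasimir X Y T = (LinearMap.trace F V T *
      (Matrix.of fun p q => LinearMap.trace F V (X p * Y q)).det) • (1 : End F V) := by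
  let gram : End F V [⋀^ι]→ₗ[F] F := Matrix.detRowAlternating.compLinearMap
    (LinearMap.pi fun q => LinearMap.trace F V ∘ₗ LinearMap.mulRight F (Y q))
  have hgram (X : ι → End F V) :
      gram X = ∑ σ : Perm ι, Perm.sign σ • ∏ q, LinearMap.trace F V (X (σ q) * Y q) :=
    Matrix.det_apply _
  have hprod (Z : End F V) (σ : Perm ι) (p : ι) :
      ∏ q, LinearMap.trace F V (update X (σ p) (Z * X (σ p) * T) (σ q) * Y q) =
        LinearMap.trace F V (Z * (X (σ p) * T * Y p)) *
          ∏ q ∈ univ.erase p, LinearMap.trace F V (X (σ q) * Y q) := by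
    rw [← Finset.mul_prod_erase _ _ (mem_univ p), update_self]
    refine congrArg₂ _ (by simp only [mul_assoc]) ?_
    refine Finset.prod_congr rfl fun q hq => ?_
    rw [update_of_ne (σ.injective.ne (Finset.ne_of_mem_erase hq))]
  refine eq_of_trace_mul_eq fun Z => ?_
  calc LinearMap.trace F V (Z * gramCasimir X Y T)
      = ∑ p, ∑ σ : Perm ι, Perm.sign σ •
          ∏ q, LinearMap.trace F V (update X (σ p) (Z * X (σ p) * T) (σ q) * Y q) := by
        simp only [gramCasimir, hprod, Finset.mul_sum, map_sum, Units.smul_def, mul_smul_comm,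
          map_zsmul, map_smul, smul_eq_mul, mul_comm]
    _ = ∑ p, gram (update X p (LinearMap.mulLeftRight F (Z, T) (X p))) := by
        simp only [hgram, LinearMap.mulLeftRight_apply]
        rw [Finset.sum_comm, Finset.sum_comm (s := univ (α := ι))]
        refine Finset.sum_congr rfl fun σ _ => ?_
        exact Equiv.sum_comp σ fun r => Perm.sign σ •
          ∏ q, LinearMap.trace F V (update X r (Z * X r * T) (σ q) * Y q)
    _ = (LinearMap.trace F V Z * LinearMap.trace F V T) * gram X := by
        rw [sum_alternatingMap_update ((finBasis F (End F V)).reindex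
          (Fintype.equivFinOfCardEq hι).symm), trace_mulLeftRight, smul_eq_mul]
    _ = _ := by
        rw [mul_smul_comm, mul_one, map_smul, smul_eq_mul]
        exact (mul_assoc _ _ _).trans (mul_comm _ _)

theorem span_mulLeftRight_eq_top [Nontrivial V] {S : Set (End F V)} (hS : Submodule.span F S = ⊤) :
    Submodule.span F (Set.image2 (fun A B => LinearMap.mulLeftRight F (A, B)) S S) = ⊤ := by
  let b := finBasis F V
  have : Nonempty (Fin (finrank F V)) := b.index_nonempty
  have : IsAzumaya F (Matrix (Fin (finrank F V)) (Fin (finrank F V)) F) := IsAzumaya.matrix F _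
  have : IsAzumaya F (End F V) := IsAzumaya.of_AlgEquiv F _ _ (algEquivMatrix b).symm
  let f : End F V →ₗ[F] End F V →ₗ[F] End F (End F V) :=
    ((TensorProduct.mk F (End F V) (End F V)ᵐᵒᵖ).compl₂
      (MulOpposite.opLinearEquiv F).toLinearMap).compr₂
        (AlgHom.mulLeftRight F (End F V)).toLinearMap
  have hf (A B : End F V) : f A B = LinearMap.mulLeftRight F (A, B) := by
    ext1 X
    simp [f]
  simp only [← hf, ← Submodule.map₂_span_span, hS]
  refine Submodule.eq_top_iff'.2 fun Φ => ?_
  obtain ⟨x, rfl⟩ := (IsAzumaya.AlgHom.mulLeftRight_bij F (End F V)).surjective Φ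
  induction x with
  | zero => simp
  | tmul A B =>
    exact Submodule.apply_mem_map₂ f (Submodule.mem_top (x := A)) (Submodule.mem_top (x := B.unop))
  | add x y hx hy => exact map_add (AlgHom.mulLeftRight F (End F V)) x y ▸ add_mem hx hy

theorem exists_mem_capelli_ne_zero [Nontrivial V] {S : Set (End F V)}
    (hS : Submodule.span F S = ⊤) {n : ℕ} {x : Fin n → End F V} (hx : LinearIndependent F x) :
    ∃ a b : Fin n → End F V, (∀ i, a i ∈ S) ∧ (∀ i, b i ∈ S) ∧ capelli a b x ≠ 0 := by
  obtain ⟨Ψ, hΨ, hne⟩ := exists_alternatization_prod_ne_zero hx (span_mulLeftRight_eq_top hS)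
  choose a ha b hb hab using hΨ
  obtain rfl : (fun i => LinearMap.mulLeftRight F (a i, b i)) = Ψ := funext hab
  exact ⟨a, b, ha, hb, capelli_eq_alternatization (R := F) a b x ▸ hne⟩

theorem exists_mem_trace_mul_ne_zero {S : Set (End F V)} (hS : Submodule.span F S = ⊤)
    {A : End F V} (hA : A ≠ 0) : ∃ Z ∈ S, LinearMap.trace F V (A * Z) ≠ 0 := by
  by_contra! h
  have h0 : LinearMap.trace F V ∘ₗ LinearMap.mulLeft F A = 0 := LinearMap.ext_on hS h
  refine hA (eq_of_trace_mul_eq fun Z => ?_)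
  rw [LinearMap.trace_mul_comm, mul_zero, map_zero]
  exact LinearMap.congr_fun h0 Z

theorem exists_basis_forall_mem {S : Set V} (hS : Submodule.span F S = ⊤) :
    ∃ X : Basis (Fin (finrank F V)) F V, ∀ i, X i ∈ S :=
  ⟨(Basis.ofSpan hS.ge).reindex ((Basis.ofSpan hS.ge).indexEquiv (finBasis F V)), fun i => by
    rw [Basis.reindex_apply]
    exact Basis.ofSpan_subset hS.ge ⟨_, rfl⟩⟩

end Endomorphisms

section Density

variable {F H L : Type*} [Field F] [Ring H] [Algebra F H] [LieRing L] [LieAlgebra F L]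
  {ρ : H →ₐ[F] End F L}

/-- The monoid of operators generated by the adjoint action and the action of `H`. Its linear span
is the multiplication algebra of `L`. -/
def multiplicationMonoid (ρ : H →ₐ[F] End F L) : Submonoid (End F L) :=
  Submonoid.closure (Set.range (LieAlgebra.ad F L) ∪ Set.range ρ)

/-- The multiplication algebra of `L`: the associative algebra of operators generated by the
adjoint action and the action of `H`. -/
def multiplicationAlgebra (ρ : H →ₐ[F] End F L) : Subalgebra F (End F L) :=
  Algebra.adjoin F (Set.range (LieAlgebra.ad F L) ∪ Set.range ρ)

theorem ad_mem_multiplicationAlgebra (x : L) : LieAlgebra.ad F L x ∈ multiplicationAlgebra ρ :=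
  Algebra.subset_adjoin (Or.inl ⟨x, rfl⟩)

theorem act_mem_multiplicationAlgebra (h : H) : ρ h ∈ multiplicationAlgebra ρ :=
  Algebra.subset_adjoin (Or.inr ⟨h, rfl⟩)

theorem IsHSimple.nontrivial (hs : IsHSimple ρ) : Nontrivial L := by
  by_contra h
  rw [not_nontrivial_iff_subsingleton] at h
  exact hs.1 ⟨fun _ _ => Subsingleton.elim _ _⟩

theorem IsHSimple.isHCentral [IsAlgClosed F] [FiniteDimensional F L] (hs : IsHSimple ρ) :
    IsHCentral ρ := by
  intro φ hφ hφρ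
  have := hs.nontrivial
  obtain ⟨c, hc⟩ := Module.End.exists_eigenvalue φ
  refine ⟨c, ?_⟩
  let I : LieIdeal F L :=
    { End.eigenspace φ c with
      lie_mem := fun {x _} hm => End.mapsTo_genEigenspace_of_comm (hφ x) c 1 hm }
  have hI : I = ⊤ := (hs.2 I fun h a ha =>
      End.mapsTo_genEigenspace_of_comm (hφρ h) c 1 ha).resolve_left fun h => hc <| by
    simpa [I] using congrArg (LieSubmodule.toSubmodule) h
  ext m
  exact End.mem_eigenspace_iff.1 (show m ∈ I from hI ▸ LieSubmodule.mem_top m)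

theorem IsHSimple.isSimpleModule (hs : IsHSimple ρ) :
    IsSimpleModule (multiplicationAlgebra ρ) L := by
  have := hs.nontrivial
  refine isSimpleModule_iff _ _ |>.2 { eq_bot_or_eq_top := fun N => ?_ }
  let I : LieIdeal F L :=
    { N.restrictScalars F with
      lie_mem := fun {x m} hm => N.smul_mem ⟨_, ad_mem_multiplicationAlgebra x⟩ hm }
  refine (hs.2 I fun h a ha => N.smul_mem ⟨_, act_mem_multiplicationAlgebra h⟩ ha).imp ?_ ?_
  · intro h
    ext m
    exact SetLike.ext_iff.1 h m
  · intro h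
    ext m
    exact SetLike.ext_iff.1 h m

theorem IsHCentral.exists_eq_smul (hc : IsHCentral ρ) (φ : End (multiplicationAlgebra ρ) L) :
    ∃ c : F, ∀ m, φ m = c • m := by
  obtain ⟨c, h⟩ := hc (φ.restrictScalars F)
    (fun a => LinearMap.ext fun m => φ.map_smul ⟨_, ad_mem_multiplicationAlgebra a⟩ m)
    (fun h => LinearMap.ext fun m => φ.map_smul ⟨_, act_mem_multiplicationAlgebra h⟩ m)
  exact ⟨c, LinearMap.congr_fun h⟩

theorem multiplicationAlgebra_eq_top [FiniteDimensional F L] (hs : IsHSimple ρ)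
    (hc : IsHCentral ρ) : multiplicationAlgebra ρ = ⊤ := by
  classical
  have := hs.isSimpleModule
  refine Algebra.eq_top_iff.2 fun f => ?_
  let f' : End (End (multiplicationAlgebra ρ) L) L :=
    { f with
      map_smul' := fun φ m => by
        obtain ⟨c, hφ⟩ := hc.exists_eq_smul φ
        simp [hφ] }
  obtain ⟨r, hr⟩ := jacobson_density f' (univ.image (finBasis F L))
  have hfr : f = r := (finBasis F L).ext fun i => hr _ (mem_image_of_mem _ (mem_univ i))
  exact hfr ▸ r.2

theorem span_multiplicationMonoid_eq_top [FiniteDimensional F L] (hs : IsHSimple ρ)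
    (hc : IsHCentral ρ) : Submodule.span F (multiplicationMonoid ρ : Set (End F L)) = ⊤ := by
  have h := congrArg Subalgebra.toSubmodule (multiplicationAlgebra_eq_top hs hc)
  rwa [multiplicationAlgebra, Algebra.adjoin_eq_span, Algebra.top_toSubmodule] at h

end Density

section AdPoly

variable {F H L ι κ : Type*} [Field F] [Ring H] [Algebra F H] [LieRing L] [LieAlgebra F L]

/-- The operator-valued monomial `ad (h₁ a_{i₁}) ⋯ ad (hₙ a_{iₙ}) h₀` attached to the word
`s = [(i₁, h₁), …, (iₙ, hₙ)]`. -/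
def adWord (ρ : H →ₐ[F] End F L) (s : List (ι × H)) (h₀ : H) : (ι → L) → End F L :=
  fun a => (s.map fun p => LieAlgebra.ad F L (ρ p.2 (a p.1))).prod * ρ h₀

/-- The operator-valued polynomial functions of multidegree `m`: the span of the monomials
`adWord ρ s h₀` whose variables, counted with multiplicity, form the multiset `m`. -/
def adPoly (ρ : H →ₐ[F] End F L) (m : Multiset ι) : Submodule F ((ι → L) → End F L) :=
  Submodule.span F {f | ∃ s h₀, (s.map Prod.fst : Multiset ι) = m ∧ f = adWord ρ s h₀}

variable {ρ : H →ₐ[F] End F L} {m m' : Multiset ι} {f g : (ι → L) → End F L}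

theorem adWord_mem_adPoly (s : List (ι × H)) (h₀ : H) :
    adWord ρ s h₀ ∈ adPoly ρ (s.map Prod.fst : Multiset ι) :=
  Submodule.subset_span ⟨s, h₀, rfl, rfl⟩

theorem adWord_nil (h₀ : H) : adWord ρ ([] : List (ι × H)) h₀ = fun _ => ρ h₀ := by
  ext1 a
  simp [adWord]

theorem adWord_cons (p : ι × H) (s : List (ι × H)) (h₀ : H) :
    adWord ρ (p :: s) h₀ = (fun a => LieAlgebra.ad F L (ρ p.2 (a p.1))) * adWord ρ s h₀ := by
  ext1 a
  simp [adWord, mul_assoc]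

theorem act_mem_adPoly (h : H) : (fun _ => ρ h) ∈ adPoly ρ (0 : Multiset ι) :=
  adWord_nil (ρ := ρ) (ι := ι) h ▸ adWord_mem_adPoly [] h

theorem one_mem_adPoly : (1 : (ι → L) → End F L) ∈ adPoly ρ 0 := by
  simpa only [map_one] using! act_mem_adPoly (ρ := ρ) (ι := ι) 1

theorem ad_mem_adPoly (h : H) (i : ι) :
    (fun a => LieAlgebra.ad F L (ρ h (a i))) ∈ adPoly ρ {i} := by
  have hword : (fun a => LieAlgebra.ad F L (ρ h (a i))) = adWord ρ [(i, h)] 1 := by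
    ext1 a
    simp [adWord]
  exact hword ▸ adWord_mem_adPoly [(i, h)] 1

theorem ad_apply_coord_mem_adPoly (i : ι) : (fun a => LieAlgebra.ad F L (a i)) ∈ adPoly ρ {i} := by
  simpa only [map_one, Module.End.one_apply] using ad_mem_adPoly (ρ := ρ) 1 i

theorem ad_mul_mem_adPoly (h : H) (i : ι) (hf : f ∈ adPoly ρ m) :
    (fun a => LieAlgebra.ad F L (ρ h (a i))) * f ∈ adPoly ρ (i ::ₘ m) := by
  have hle : adPoly ρ m ≤ (adPoly ρ (i ::ₘ m)).comap
      (LinearMap.mulLeft F fun a => LieAlgebra.ad F L (ρ h (a i))) := by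
    refine Submodule.span_le.2 ?_
    rintro _ ⟨s, h₀, rfl, rfl⟩
    change _ * adWord ρ s h₀ ∈ adPoly ρ _
    rw [← adWord_cons (i, h)]
    exact adWord_mem_adPoly ((i, h) :: s) h₀
  exact hle hf

theorem act_mul_adWord_mem_adPoly (hρ : IsGeneralizedAction ρ) (h : H) (s : List (ι × H))
    (h₀ : H) :
    (fun _ => ρ h) * adWord ρ s h₀ ∈ adPoly ρ (s.map Prod.fst : Multiset ι) := by
  induction s generalizing h with
  | nil =>
    have hmul : (fun _ => ρ h) * adWord ρ ([] : List (ι × H)) h₀ = fun _ => ρ (h * h₀) := by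
      funext a
      simp [adWord_nil]
    rw [hmul]
    exact act_mem_adPoly (h * h₀)
  | cons p s ih =>
    obtain ⟨n, h', h'', hh⟩ := hρ h
    have hexpand : (fun _ => ρ h) * adWord ρ (p :: s) h₀ =
        ∑ k, (fun a => LieAlgebra.ad F L (ρ (h' k * p.2) (a p.1))) *
          ((fun _ => ρ (h'' k)) * adWord ρ s h₀) := by
      ext a v
      simp [adWord, hh]
    rw [hexpand, List.map_cons, ← Multiset.cons_coe]
    exact Submodule.sum_mem _ fun k _ => ad_mul_mem_adPoly (h' k * p.2) p.1 (ih (h'' k))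

theorem mul_mem_adPoly (hρ : IsGeneralizedAction ρ) (hf : f ∈ adPoly ρ m) (hg : g ∈ adPoly ρ m') :
    f * g ∈ adPoly ρ (m + m') := by
  have hle : adPoly ρ m * adPoly ρ m' ≤ adPoly ρ (m + m') := by
    rw [adPoly, adPoly, Submodule.span_mul_span, Submodule.span_le]
    rintro _ ⟨_, ⟨s, h₀, rfl, rfl⟩, _, ⟨s', h₀', rfl, rfl⟩, rfl⟩
    change adWord ρ s h₀ * adWord ρ s' h₀' ∈ adPoly ρ _
    clear hf hg
    induction s with
    | nil => simpa [adWord_nil] using act_mul_adWord_mem_adPoly hρ h₀ s' h₀'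
    | cons p s ih =>
      rw [adWord_cons, mul_assoc, List.map_cons, ← Multiset.cons_coe, Multiset.cons_add]
      exact ad_mul_mem_adPoly p.2 p.1 ih
  exact hle (Submodule.mul_mem_mul hf hg)

theorem prod_ofFn_mem_adPoly (hρ : IsGeneralizedAction ρ) {n : ℕ} {d : Fin n → Multiset ι}
    {f : Fin n → (ι → L) → End F L} (hf : ∀ i, f i ∈ adPoly ρ (d i)) :
    (fun a => (List.ofFn fun i => f i a).prod) ∈ adPoly ρ (∑ i, d i) := by
  induction n with
  | zero => simpa using! one_mem_adPoly (ρ := ρ)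
  | succ n ih =>
    simp only [List.ofFn_succ, List.prod_cons, Fin.sum_univ_succ]
    exact mul_mem_adPoly hρ (hf 0) (ih fun i => hf i.succ)

theorem subst_mem_adPoly (hρ : IsGeneralizedAction ρ) {d : ι → Multiset κ} {y : ι → (κ → L) → L}
    (hy : ∀ i h, (fun a => LieAlgebra.ad F L (ρ h (y i a))) ∈ adPoly ρ (d i))
    (hf : f ∈ adPoly ρ m) : (fun a => f fun i => y i a) ∈ adPoly ρ (m.bind d) := by
  have hle : adPoly ρ m ≤ (adPoly ρ (m.bind d)).comap
      (LinearMap.funLeft F (End F L) fun a i => y i a) := by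
    refine Submodule.span_le.2 ?_
    rintro _ ⟨s, h₀, rfl, rfl⟩
    change (fun a => adWord ρ s h₀ fun i => y i a) ∈ adPoly ρ _
    clear hf
    induction s with
    | nil => simpa [adWord] using act_mem_adPoly (ρ := ρ) h₀
    | cons p s ih =>
      simp only [adWord_cons, List.map_cons, ← Multiset.cons_coe, Multiset.cons_bind]
      exact mul_mem_adPoly hρ (hy p.1 p.2) ih
  exact hle hf

theorem rename_mem_adPoly (hρ : IsGeneralizedAction ρ) (e : ι → κ) (hf : f ∈ adPoly ρ m) :
    (fun a => f (a ∘ e)) ∈ adPoly ρ (m.map e) := by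
  simpa using! subst_mem_adPoly hρ (fun i h => ad_mem_adPoly (ρ := ρ) h (e i)) hf

theorem ad_lie_mem_adPoly (hρ : IsGeneralizedAction ρ) {x y : (ι → L) → L}
    (hx : ∀ h, (fun a => LieAlgebra.ad F L (ρ h (x a))) ∈ adPoly ρ m)
    (hy : ∀ h, (fun a => LieAlgebra.ad F L (ρ h (y a))) ∈ adPoly ρ m') (h : H) :
    (fun a => LieAlgebra.ad F L (ρ h ⁅x a, y a⁆)) ∈ adPoly ρ (m + m') := by
  obtain ⟨n, h', h'', hh⟩ := hρ h
  have hexpand : (fun a => LieAlgebra.ad F L (ρ h ⁅x a, y a⁆)) = ∑ k,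
      ((fun a => LieAlgebra.ad F L (ρ (h' k) (x a))) *
          (fun a => LieAlgebra.ad F L (ρ (h'' k) (y a))) -
        (fun a => LieAlgebra.ad F L (ρ (h'' k) (y a))) *
          fun a => LieAlgebra.ad F L (ρ (h' k) (x a))) := by
    ext a v
    simp [hh]
  rw [hexpand]
  refine Submodule.sum_mem _ fun k _ => Submodule.sub_mem _ ?_ ?_
  · exact mul_mem_adPoly hρ (hx _) (hy _)
  · exact add_comm m m' ▸ mul_mem_adPoly hρ (hy _) (hx _)

theorem ad_apply_mem_adPoly (hρ : IsGeneralizedAction ρ) {y : (ι → L) → L}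
    (hf : f ∈ adPoly ρ m)
    (hy : ∀ h, (fun a => LieAlgebra.ad F L (ρ h (y a))) ∈ adPoly ρ m') (h : H) :
    (fun a => LieAlgebra.ad F L (ρ h (f a (y a)))) ∈ adPoly ρ (m + m') := by
  induction hf using Submodule.span_induction with
  | mem f hf =>
    obtain ⟨s, h₀, rfl, rfl⟩ := hf
    induction s generalizing h with
    | nil => simpa [adWord, Module.End.mul_apply, map_mul] using hy (h * h₀)
    | cons p s ih =>
      have hx (h : H) : (fun a : ι → L => LieAlgebra.ad F L (ρ h (ρ p.2 (a p.1)))) ∈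
          adPoly ρ {p.1} := by
        simpa only [map_mul] using! ad_mem_adPoly (ρ := ρ) (h * p.2) p.1
      have := ad_lie_mem_adPoly hρ hx ih h
      simpa [adWord_cons, ← Multiset.cons_coe, Multiset.cons_add] using this
  | zero =>
    simp only [Pi.zero_apply, LinearMap.zero_apply, map_zero]
    exact zero_mem _
  | add f g _ _ hf hg =>
    simp only [Pi.add_apply, LinearMap.add_apply, map_add]
    exact add_mem hf hg
  | smul c f _ hf =>
    simp only [Pi.smul_apply, LinearMap.smul_apply, map_smul]
    exact Submodule.smul_mem _ c hf

end AdPoly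

theorem sum_singleton_eq_map_univ {α β : Type*} [Fintype α] (u : α → β) :
    ∑ i, ({u i} : Multiset β) = (univ : Finset α).val.map u := by
  rw [← Multiset.sum_map_singleton ((univ : Finset α).val.map u), Multiset.map_map]
  rfl

section DetCoeff

variable {F H L η κ μ : Type*} [Field F] [Ring H] [Algebra F H] [LieRing L] [LieAlgebra F L]
  [Fintype η] [DecidableEq η] {ρ : H →ₐ[F] End F L} {l : Basis η F L} {m m' : Multiset κ}
  {f g : (κ → L) → End F L}

/-- The functions `g` for which `l.det x • g a` is an operator-valued polynomial function of the
family `x` of vectors indexed by `η` and of `a`, of degree one in each of the former and of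
multidegree `m` in the latter. The determinant pays for multiplication by traces, which `adPoly`
does not allow. -/
noncomputable def detCoeff (ρ : H →ₐ[F] End F L) (l : Basis η F L) (m : Multiset κ) :
    Submodule F ((κ → L) → End F L) :=
  (adPoly ρ ((univ : Finset η).val.map Sum.inl + m.map Sum.inr)).comap
    (LinearMap.pi fun a : η ⊕ κ → L => l.det (a ∘ Sum.inl) • LinearMap.proj (a ∘ Sum.inr))

theorem mem_detCoeff : g ∈ detCoeff ρ l m ↔
    (fun a : η ⊕ κ → L => l.det (a ∘ Sum.inl) • g (a ∘ Sum.inr)) ∈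
      adPoly ρ ((univ : Finset η).val.map Sum.inl + m.map Sum.inr) :=
  Iff.rfl

theorem mul_mem_detCoeff (hρ : IsGeneralizedAction ρ) (hf : f ∈ adPoly ρ m)
    (hg : g ∈ detCoeff ρ l m') : f * g ∈ detCoeff ρ l (m + m') := by
  have hmul := mul_mem_adPoly hρ (rename_mem_adPoly hρ Sum.inr hf) (mem_detCoeff.1 hg)
  rw [mem_detCoeff, Multiset.map_add, add_left_comm]
  refine (congrArg (· ∈ adPoly ρ _) ?_).mp hmul
  funext a
  simp only [Pi.mul_apply, mul_smul_comm]

theorem mul_mem_detCoeff_right (hρ : IsGeneralizedAction ρ) (hg : g ∈ detCoeff ρ l m)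
    (hf : f ∈ adPoly ρ m') : g * f ∈ detCoeff ρ l (m + m') := by
  have hmul := mul_mem_adPoly hρ (mem_detCoeff.1 hg) (rename_mem_adPoly hρ Sum.inr hf)
  rw [mem_detCoeff, Multiset.map_add, ← add_assoc]
  refine (congrArg (· ∈ adPoly ρ _) ?_).mp hmul
  funext a
  simp only [Pi.mul_apply, smul_mul_assoc]

theorem rename_mem_detCoeff (hρ : IsGeneralizedAction ρ) (e : κ → μ) (hg : g ∈ detCoeff ρ l m) :
    (fun a => g (a ∘ e)) ∈ detCoeff ρ l (m.map e) := by
  have hren := rename_mem_adPoly hρ (Sum.map id e) (mem_detCoeff.1 hg)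
  simpa only [mem_detCoeff, Multiset.map_add, Multiset.map_map, comp_def, Sum.map_inl, Sum.map_inr,
    id] using hren

/-- The functions multiplication by which maps `detCoeff ρ l m'` to `detCoeff ρ l (m + m')`. -/
noncomputable def detMultiplier (ρ : H →ₐ[F] End F L) (l : Basis η F L) (m : Multiset κ) :
    Submodule F ((κ → L) → F) where
  carrier := {c | ∀ m' g, g ∈ detCoeff ρ l m' → (fun a => c a • g a) ∈ detCoeff ρ l (m + m')}
  add_mem' hb hc m' g hg := by
    simpa only [Pi.add_apply, add_smul] using! add_mem (hb m' g hg) (hc m' g hg)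
  zero_mem' m' g _ := by
    simpa only [Pi.zero_apply, zero_smul] using! zero_mem (detCoeff ρ l (m + m'))
  smul_mem' r c hc m' g hg := by
    simpa only [Pi.smul_apply, smul_assoc] using! Submodule.smul_mem _ r (hc m' g hg)

theorem prod_mem_detMultiplier {α : Type*} (s : Finset α) {d : α → Multiset κ}
    {c : α → (κ → L) → F} (hc : ∀ i ∈ s, c i ∈ detMultiplier ρ l (d i)) :
    (fun a => ∏ i ∈ s, c i a) ∈ detMultiplier ρ l (∑ i ∈ s, d i) := by
  classical
  induction s using Finset.induction_on with
  | empty =>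
    intro m g hg
    simpa using hg
  | insert i s hi ih =>
    intro m g hg
    have hs := ih (fun j hj => hc j (mem_insert_of_mem hj)) m g hg
    simpa only [prod_insert hi, sum_insert hi, mul_smul, add_assoc] using
      hc i (mem_insert_self i s) _ _ hs

theorem det_update_apply_smul_mem_adPoly (hρ : IsGeneralizedAction ρ) (hf : f ∈ adPoly ρ m)
    (hg : g ∈ detCoeff ρ l m') (i : η) :
    (fun a : η ⊕ κ → L => l.det (update (a ∘ Sum.inl) i (f (a ∘ Sum.inr) (a (Sum.inl i)))) •
      g (a ∘ Sum.inr)) ∈ adPoly ρ ((univ : Finset η).val.map Sum.inl + (m + m').map Sum.inr) := by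
  classical
  let y (x : η ⊕ κ) (a : η ⊕ κ → L) : L :=
    update a (Sum.inl i) (f (a ∘ Sum.inr) (a (Sum.inl i))) x
  let deg (x : η ⊕ κ) : Multiset (η ⊕ κ) := (if x = Sum.inl i then m.map Sum.inr else 0) + {x}
  have hy (x : η ⊕ κ) (h : H) :
      (fun a => LieAlgebra.ad F L (ρ h (y x a))) ∈ adPoly ρ (deg x) := by
    by_cases hx : x = Sum.inl i
    · subst hx
      simpa only [y, deg, update_self, if_true] using ad_apply_mem_adPoly hρ
        (rename_mem_adPoly hρ Sum.inr hf) (fun h => ad_mem_adPoly h (Sum.inl i)) h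
    · simpa only [y, deg, update_of_ne hx, if_neg hx, zero_add] using ad_mem_adPoly h x
  have hdeg : ((univ : Finset η).val.map Sum.inl + m'.map Sum.inr).bind deg =
      (univ : Finset η).val.map Sum.inl + (m + m').map Sum.inr := by
    have hite : (univ : Finset η).val.bind (fun j => if j = i then m.map Sum.inr else 0) =
        m.map (Sum.inr : κ → η ⊕ κ) :=
      (Finset.sum_ite_eq' univ i fun _ => m.map Sum.inr).trans (if_pos (mem_univ i))
    simp only [deg, Multiset.bind_add, Multiset.bind_singleton, Multiset.add_bind,
      Multiset.bind_map, Sum.inl.injEq, reduceCtorEq, if_false, Multiset.bind_zero, hite,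
      Multiset.map_add]
    abel
  have hinl (a : η ⊕ κ → L) : (fun x => y x a) ∘ Sum.inl =
      update (a ∘ Sum.inl) i (f (a ∘ Sum.inr) (a (Sum.inl i))) :=
    update_comp_eq_of_injective a Sum.inl_injective i _
  have hinr (a : η ⊕ κ → L) : (fun x => y x a) ∘ Sum.inr = a ∘ Sum.inr :=
    update_comp_eq_of_notMem_range a _ (by simp)
  simpa only [hdeg, hinl, hinr] using subst_mem_adPoly hρ hy (mem_detCoeff.1 hg)

theorem trace_mem_detMultiplier (hρ : IsGeneralizedAction ρ) (hf : f ∈ adPoly ρ m) :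
    (fun a => LinearMap.trace F L (f a)) ∈ detMultiplier ρ l m := by
  intro m' g hg
  have hsum : (fun a : η ⊕ κ → L =>
      l.det (a ∘ Sum.inl) • LinearMap.trace F L (f (a ∘ Sum.inr)) • g (a ∘ Sum.inr)) =
        ∑ i, fun a => l.det (update (a ∘ Sum.inl) i (f (a ∘ Sum.inr) (a (Sum.inl i)))) •
          g (a ∘ Sum.inr) := by
    funext a
    rw [Finset.sum_apply, ← Finset.sum_smul, smul_comm, ← smul_assoc]
    exact congrArg (· • g (a ∘ Sum.inr))
      (sum_alternatingMap_update l l.det _ (a ∘ Sum.inl)).symm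
  rw [mem_detCoeff, hsum]
  exact Submodule.sum_mem _ fun i _ => det_update_apply_smul_mem_adPoly hρ hf hg i

theorem det_trace_mul_mem_detMultiplier {α : Type*} [Fintype α] [DecidableEq α]
    (hρ : IsGeneralizedAction ρ) {d d' : α → Multiset κ} {X Y : α → (κ → L) → End F L}
    (hX : ∀ i, X i ∈ adPoly ρ (d i)) (hY : ∀ i, Y i ∈ adPoly ρ (d' i)) :
    (fun a => (Matrix.of fun i j => LinearMap.trace F L (X i a * Y j a)).det) ∈
      detMultiplier ρ l (∑ i, d i + ∑ i, d' i) := by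
  have hdet : (fun a => (Matrix.of fun i j => LinearMap.trace F L (X i a * Y j a)).det) =
      ∑ σ : Perm α, (Perm.sign σ : ℤ) • fun a => ∏ i, LinearMap.trace F L (X (σ i) a * Y i a) := by
    funext a
    simp [Matrix.det_apply, Units.smul_def]
  rw [hdet]
  refine Submodule.sum_mem _ fun σ _ => zsmul_mem ?_ _
  rw [← Equiv.sum_comp σ d, ← Finset.sum_add_distrib]
  exact prod_mem_detMultiplier univ fun i _ =>
    trace_mem_detMultiplier hρ (mul_mem_adPoly hρ (hX (σ i)) (hY i))

/-- The Killing form is a trace, and its Gram matrix at `u` and `v` has determinant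
`det u * det v` up to a non-zero constant. -/
theorem det_mul_det_mem_detMultiplier [LieAlgebra.IsKilling F L]
    (hρ : IsGeneralizedAction ρ) (u v : η → κ) :
    (fun a => l.det (a ∘ u) * l.det (a ∘ v)) ∈
      detMultiplier ρ l ((univ : Finset η).val.map u + (univ : Finset η).val.map v) := by
  have : FiniteDimensional F L := l.finiteDimensional_of_finite
  have hdet := (LinearMap.BilinForm.nondegenerate_iff_det_ne_zero l).1
    (LieAlgebra.IsKilling.killingForm_nondegenerate F L)
  have hgram := det_trace_mul_mem_detMultiplier (l := l) hρ
    (fun i => ad_apply_coord_mem_adPoly (ρ := ρ) (u i)) fun i => ad_apply_coord_mem_adPoly (v i)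
  rw [sum_singleton_eq_map_univ, sum_singleton_eq_map_univ] at hgram
  refine (Submodule.smul_mem_iff _ hdet).1 ((congrArg (· ∈ detMultiplier ρ l _) ?_).mp hgram)
  funext a
  exact det_bilinForm_apply l (killingForm F L) (a ∘ u) (a ∘ v)

theorem prod_det_mem_detMultiplier [LieAlgebra.IsKilling F L]
    (hρ : IsGeneralizedAction ρ) (k : ℕ) (u : Fin (2 * k) → η → κ) :
    (fun a => ∏ j, l.det (a ∘ u j)) ∈ detMultiplier ρ l (∑ j, (univ : Finset η).val.map (u j)) := by
  have hpair := prod_mem_detMultiplier univ fun (i : Fin k) _ => det_mul_det_mem_detMultiplier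
    (l := l) hρ (u (finProdFinEquiv (0, i))) (u (finProdFinEquiv (1, i)))
  simp only [← finProdFinEquiv.prod_comp, ← finProdFinEquiv.sum_comp, Fintype.prod_prod_type,
    Fintype.sum_prod_type, Fin.prod_univ_two, Fin.sum_univ_two, ← prod_mul_distrib,
    ← sum_add_distrib]
  exact hpair

theorem gramCasimir_mem_detCoeff {α : Type*} [Fintype α] [DecidableEq α]
    (hρ : IsGeneralizedAction ρ) {d d' : α → Multiset κ}
    {X Y : α → (κ → L) → End F L} {T : (κ → L) → End F L} (hX : ∀ p, X p ∈ adPoly ρ (d p))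
    (hY : ∀ p, Y p ∈ adPoly ρ (d' p)) (hT : T ∈ detCoeff ρ l m) :
    (fun a => gramCasimir (fun p => X p a) (fun p => Y p a) (T a)) ∈
      detCoeff ρ l (∑ p, d p + ∑ p, d' p + m) := by
  have hterm (p : α) (σ : Perm α) :
      (fun a => (∏ q ∈ univ.erase p, LinearMap.trace F L (X (σ q) a * Y q a)) •
        (X (σ p) a * T a * Y p a)) ∈ detCoeff ρ l (∑ p, d p + ∑ p, d' p + m) := by
    have hdeg : ∑ p, d p + ∑ p, d' p + m =
        ∑ q ∈ univ.erase p, (d (σ q) + d' q) + (d (σ p) + m + d' p) := by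
      rw [← Equiv.sum_comp σ d, ← Finset.sum_add_distrib, ← Finset.sum_erase_add _ _ (mem_univ p)]
      abel
    rw [hdeg]
    exact prod_mem_detMultiplier (univ.erase p) (fun q _ => trace_mem_detMultiplier hρ
      (mul_mem_adPoly hρ (hX (σ q)) (hY q))) _ _
      (mul_mem_detCoeff_right hρ (mul_mem_detCoeff hρ (hX (σ p)) hT) (hY p))
  simp only [gramCasimir]
  rw [← Finset.sum_fn]
  refine Submodule.sum_mem _ fun p _ => ?_
  rw [← Finset.sum_fn]
  exact Submodule.sum_mem _ fun σ _ => zsmul_mem (hterm p σ) (Perm.sign σ : ℤ)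

theorem prod_ofFn_mul_ad_mul_mem_adPoly {t : ℕ} (hρ : IsGeneralizedAction ρ)
    {d d' : Fin t → Multiset κ} {A B : Fin t → (κ → L) → End F L}
    (hA : ∀ i, A i ∈ adPoly ρ (d i)) (hB : ∀ i, B i ∈ adPoly ρ (d' i)) (σ : Perm (Fin t)) :
    (fun a : Fin t ⊕ κ → L => (List.ofFn fun i => A i (a ∘ Sum.inr) *
      LieAlgebra.ad F L (a (Sum.inl (σ i))) * B i (a ∘ Sum.inr)).prod) ∈
      adPoly ρ ((univ : Finset (Fin t)).val.map Sum.inl + (∑ i, d i + ∑ i, d' i).map Sum.inr) := by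
  have hdeg : (univ : Finset (Fin t)).val.map Sum.inl + (∑ i, d i + ∑ i, d' i).map Sum.inr =
      ∑ i, ((d i).map Sum.inr + {Sum.inl (σ i)} + (d' i).map Sum.inr) := by
    rw [← sum_singleton_eq_map_univ, ← Equiv.sum_comp σ, Finset.sum_add_distrib,
      Finset.sum_add_distrib, Multiset.map_add, ← Multiset.coe_mapAddMonoidHom, map_sum, map_sum]
    simp only [Multiset.coe_mapAddMonoidHom]
    abel
  rw [hdeg]
  exact prod_ofFn_mem_adPoly hρ fun i => mul_mem_adPoly hρ (mul_mem_adPoly hρ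
    (rename_mem_adPoly hρ Sum.inr (hA i)) (ad_apply_coord_mem_adPoly (Sum.inl (σ i))))
    (rename_mem_adPoly hρ Sum.inr (hB i))

theorem capelli_ad_mem_detCoeff {t : ℕ} {l : Basis (Fin t) F L} (hρ : IsGeneralizedAction ρ)
    {d d' : Fin t → Multiset κ} {A B : Fin t → (κ → L) → End F L}
    (hA : ∀ i, A i ∈ adPoly ρ (d i)) (hB : ∀ i, B i ∈ adPoly ρ (d' i)) :
    (fun a => capelli (fun i => A i a) (fun i => B i a) fun i => LieAlgebra.ad F L (l i)) ∈
      detCoeff ρ l (∑ i, d i + ∑ i, d' i) := by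
  have hdet (a b : Fin t → End F L) (x : Fin t → L) :
      l.det x • capelli a b (fun i => LieAlgebra.ad F L (l i)) =
        capelli a b fun i => LieAlgebra.ad F L (x i) := by
    rw [capelli_eq_alternatization (R := F), capelli_eq_alternatization (R := F)]
    exact (alternatingMap_apply_eq_det_smul l ((MultilinearMap.alternatization _).compLinearMap
      (LieAlgebra.ad F L : L →ₗ[F] End F L)) x).symm
  rw [mem_detCoeff]
  simp only [hdet]
  simp only [capelli]
  rw [← Finset.sum_fn]
  exact Submodule.sum_mem _ fun σ _ =>
    zsmul_mem (prod_ofFn_mul_ad_mul_mem_adPoly hρ hA hB σ) (Perm.sign σ : ℤ)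

end DetCoeff

section Evaluation

variable {F H L : Type*} [Field F] [Ring H] [Algebra F H] [LieRing L] [LieAlgebra F L]
  {ρ : H →ₐ[F] End F L}

theorem exists_mem_adPoly_apply_eq (hρ : IsGeneralizedAction ρ) {T : End F L}
    (hT : T ∈ multiplicationMonoid ρ) :
    ∃ (κ : Type) (_ : Fintype κ) (f : (κ → L) → End F L) (w : κ → L),
      f ∈ adPoly ρ univ.val ∧ f w = T := by
  induction hT using Submonoid.closure_induction with
  | mem T hT =>
    obtain ⟨x, rfl⟩ | ⟨h, rfl⟩ := hT
    · exact ⟨Unit, inferInstance, _, fun _ => x, ad_apply_coord_mem_adPoly (), rfl⟩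
    · exact ⟨Empty, inferInstance, _, Empty.elim, act_mem_adPoly h, rfl⟩
  | one => exact ⟨Empty, inferInstance, _, Empty.elim, one_mem_adPoly, rfl⟩
  | mul S T _ _ hS hT =>
    obtain ⟨κ, _, f, w, hf, rfl⟩ := hS
    obtain ⟨κ', _, g, w', hg, rfl⟩ := hT
    exact ⟨κ ⊕ κ', inferInstance, _, Sum.elim w w', mul_mem_adPoly hρ
      (rename_mem_adPoly hρ Sum.inl hf) (rename_mem_adPoly hρ Sum.inr hg), rfl⟩

theorem exists_family_mem_adPoly_apply_eq (hρ : IsGeneralizedAction ρ) {J : Type} [Fintype J]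
    {V : J → End F L} (hV : ∀ j, V j ∈ multiplicationMonoid ρ) :
    ∃ (κ : Type) (_ : Fintype κ) (d : J → Multiset κ) (S : J → (κ → L) → End F L) (w : κ → L),
      ∑ j, d j = univ.val ∧ ∀ j, S j ∈ adPoly ρ (d j) ∧ S j w = V j := by
  choose κ _ f w hf hfw using fun j => exists_mem_adPoly_apply_eq hρ (hV j)
  exact ⟨Σ j, κ j, inferInstance, fun j => univ.val.map (Sigma.mk j),
    fun j a => f j (a ∘ Sigma.mk j), fun p => w p.1 p.2, rfl, fun j =>
    ⟨rename_mem_adPoly hρ (Sigma.mk j) (hf j), hfw j⟩⟩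

variable [LieAlgebra.IsKilling F L]

theorem exists_mem_detCoeff_apply_eq_one {t : ℕ} (l : Basis (Fin t) F L)
    (hρ : IsGeneralizedAction ρ) (hs : IsHSimple ρ) (hc : IsHCentral ρ) :
    ∃ (κ : Type) (_ : Fintype κ) (g : (κ → L) → End F L) (w : κ → L),
      g ∈ detCoeff ρ l univ.val ∧ g w = 1 := by
  have : FiniteDimensional F L := l.finiteDimensional_of_finite
  have := hs.nontrivial
  have hspan := span_multiplicationMonoid_eq_top hs hc
  have hindep : LinearIndependent F fun i => LieAlgebra.ad F L (l i) :=
    l.linearIndependent.map' (LieAlgebra.ad F L : L →ₗ[F] End F L) <|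
      (LieSubmodule.toSubmodule_eq_bot _).2 (LieAlgebra.ad_ker_eq_bot_of_hasTrivialRadical F L)
  obtain ⟨A, B, hA, hB, hne⟩ := exists_mem_capelli_ne_zero hspan hindep
  obtain ⟨Z, hZ, htr⟩ := exists_mem_trace_mul_ne_zero hspan hne
  obtain ⟨X, hX⟩ := exists_basis_forall_mem hspan
  let V := Sum.elim (Sum.elim X X) (Sum.elim (Sum.elim A B) fun _ : Unit => Z)
  have hV (j) : V j ∈ multiplicationMonoid ρ := by
    rcases j with (p | p) | ((i | i) | _)
    exacts [hX p, hX p, hA i, hB i, hZ]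
  obtain ⟨κ, _, d, S, w, hd, hS⟩ := exists_family_mem_adPoly_apply_eq hρ hV
  let T := capelli A B (fun i => LieAlgebra.ad F L (l i)) * Z
  let D := (Matrix.of fun p q => LinearMap.trace F L (X p * X q)).det
  have hmem := gramCasimir_mem_detCoeff hρ (fun p => (hS (.inl (.inl p))).1)
    (fun p => (hS (.inl (.inr p))).1) <| mul_mem_detCoeff_right hρ
    (capelli_ad_mem_detCoeff (l := l) hρ (fun i => (hS (.inr (.inl (.inl i)))).1)
      (fun i => (hS (.inr (.inl (.inr i)))).1)) (hS (.inr (.inr ()))).1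
  have hvalue : gramCasimir X X T = (LinearMap.trace F L T * D) • (1 : End F L) :=
    gramCasimir_eq_smul_one (Fintype.card_fin _) X X T
  have hdeg : univ.val = ∑ p, d (.inl (.inl p)) + ∑ p, d (.inl (.inr p)) +
      (∑ i, d (.inr (.inl (.inl i))) + ∑ i, d (.inr (.inl (.inr i))) + d (.inr (.inr ()))) := by
    simp [← hd, Fintype.sum_sum_type]
  refine ⟨κ, inferInstance, _, w,
    hdeg ▸ Submodule.smul_mem _ (LinearMap.trace F L T * D)⁻¹ hmem, ?_⟩
  simp only [Pi.smul_apply, Pi.mul_apply, hS]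
  exact (congrArg _ hvalue).trans
    (inv_smul_smul₀ (mul_ne_zero htr (det_trace_mul_ne_zero X)) 1)

theorem exists_prod_det_smul_mem_adPoly {t : ℕ} (l : Basis (Fin t) F L)
    (hρ : IsGeneralizedAction ρ) (hs : IsHSimple ρ) (hc : IsHCentral ρ) :
    ∃ (C : ℕ) (w : Fin C → L) (g : (Fin C → L) → End F L), 0 < C ∧ g w = 1 ∧ ∀ k : ℕ,
      (fun a : (Fin (2 * k) × Fin t) ⊕ Fin C → L =>
        (∏ j, l.det fun i => a (Sum.inl (j, i))) • g (a ∘ Sum.inr)) ∈ adPoly ρ univ.val := by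
  obtain ⟨κ, _, g, w, hg, hgw⟩ := exists_mem_detCoeff_apply_eq_one l hρ hs hc
  have := hs.nontrivial
  have : Nonempty (Fin t) := l.index_nonempty
  let e : Fin t ⊕ κ ≃ Fin (Fintype.card (Fin t ⊕ κ)) := Fintype.equivFin _
  refine ⟨_, Sum.elim l w ∘ e.symm, fun b => l.det (b ∘ e ∘ Sum.inl) • g (b ∘ e ∘ Sum.inr),
    Fintype.card_pos, ?_, fun k => ?_⟩
  · simp only [← comp_assoc, comp_assoc _ e.symm, e.symm_comp_self, comp_id, Sum.elim_comp_inl,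
      Sum.elim_comp_inr, l.det_self, hgw, one_smul]
  · have hmul := mem_detCoeff.1 <| prod_det_mem_detMultiplier hρ k (fun j i => Sum.inl (j, i)) _ _
      (rename_mem_detCoeff hρ (Sum.inr : κ → (Fin (2 * k) × Fin t) ⊕ κ) hg)
    let r := (Equiv.sumAssoc (Fin t) (Fin (2 * k) × Fin t) κ).symm.trans <|
      ((Equiv.sumComm _ _).sumCongr (Equiv.refl κ)).trans <|
        (Equiv.sumAssoc _ _ _).trans <| (Equiv.refl _).sumCongr e
    have hdeg : ∑ j, (univ : Finset (Fin t)).val.map (fun i => (Sum.inl (j, i) : _ ⊕ κ)) =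
        (univ : Finset (Fin (2 * k) × Fin t)).val.map Sum.inl := by
      simp only [← sum_singleton_eq_map_univ, Fintype.sum_prod_type]
    have hrename := rename_mem_adPoly hρ r hmul
    rw [hdeg] at hrename
    refine (congrArg₂ (fun f m => f ∈ adPoly ρ m) ?_ (Multiset.map_univ_val_equiv r)).mp hrename
    funext a
    exact smul_comm _ _ _

end Evaluation

section Polynomials

variable {F H L X Y Z ι : Type*} [Field F] [Ring H] [Algebra F H] [LieRing L] [LieAlgebra F L]

theorem HPoly.eval_var (ρ : H →ₐ[F] End F L) (a : X → L) (x : X) (h : H) :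
    HPoly.eval ρ a (HPoly.var F x h) = ρ h (a x) := by
  conv_rhs => rw [← (Basis.ofVectorSpace F H).linearCombination_repr h,
    Finsupp.linearCombination_apply]
  simp [HPoly.var, HPoly.eval, Finsupp.sum]

theorem HPoly.eval_rename (ρ : H →ₐ[F] End F L) (a : Y → L) (s : X → Y) (f : HPoly F H X) :
    HPoly.eval ρ a (HPoly.rename s f) = HPoly.eval ρ (a ∘ s) f := by
  have hcomp : (HPoly.eval ρ a).comp (HPoly.rename s) = HPoly.eval ρ (a ∘ s) := by
    ext p
    simp [HPoly.eval, HPoly.rename]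
  exact LieHom.congr_fun hcomp f

theorem HPoly.rename_rename (s : X → Y) (r : Y → Z) (f : HPoly F H X) :
    HPoly.rename r (HPoly.rename s f) = HPoly.rename (r ∘ s) f := by
  have hcomp : (HPoly.rename r).comp (HPoly.rename s) = HPoly.rename (F := F) (H := H) (r ∘ s) := by
    ext p
    simp [HPoly.rename]
  exact LieHom.congr_fun hcomp f

theorem HPoly.rename_var (s : X → Y) (x : X) (h : H) :
    HPoly.rename s (HPoly.var F x h) = HPoly.var F (s x) h := by
  simp [HPoly.var, HPoly.rename, Finsupp.sum]

theorem map_leftNormed {M N : Type*} [LieRing M] [LieAlgebra F M] [LieRing N] [LieAlgebra F N]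
    (φ : M →ₗ⁅F⁆ N) (s : List M) : φ (leftNormed s) = leftNormed (s.map φ) := by
  cases s with
  | nil => exact map_zero φ
  | cons x s =>
    exact (List.foldl_hom φ fun u v => (φ.map_lie u v).symm).symm.trans (List.foldl_map ..).symm

theorem HPoly.rename_mem_multilinear [Fintype X] (σ : Perm X) {f : HPoly F H X}
    (hf : f ∈ HPoly.multilinear F H X) : HPoly.rename σ f ∈ HPoly.multilinear F H X := by
  have hle : HPoly.multilinear F H X ≤ (HPoly.multilinear F H X).comap
      (HPoly.rename σ : HPoly F H X →ₗ⁅F⁆ HPoly F H X).toLinearMap := by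
    refine Submodule.span_le.2 ?_
    rintro _ ⟨e, h, rfl⟩
    refine Submodule.subset_span ⟨e.trans σ, h, ?_⟩
    simp [map_leftNormed, List.map_ofFn, comp_def, HPoly.rename_var]
  exact hle hf

theorem HPoly.leftNormed_mem_multilinear [Fintype X] (s : List (X × H))
    (hs : (s.map Prod.fst : Multiset X) = univ.val) :
    leftNormed (s.map fun p => HPoly.var F p.1 p.2) ∈ HPoly.multilinear F H X := by
  have hlen : s.length = Fintype.card X := by
    simpa using congrArg Multiset.card hs
  have hnodup : (s.map Prod.fst).Nodup := by
    rw [← Multiset.coe_nodup, hs]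
    exact univ.nodup
  have hinj : Injective fun i : Fin (Fintype.card X) => (s.get (i.cast hlen.symm)).1 := by
    intro i j hij
    have hget := List.nodup_iff_injective_get.1 hnodup
      (a₁ := i.cast (by simp [hlen])) (a₂ := j.cast (by simp [hlen])) (by simpa using hij)
    simpa [Fin.ext_iff] using hget
  refine Submodule.subset_span ⟨Equiv.ofBijective _
    ((Fintype.bijective_iff_injective_and_card _).2 ⟨hinj, Fintype.card_fin _⟩),
    fun i => (s.get (i.cast hlen.symm)).2, congrArg leftNormed ?_⟩
  exact List.ext_getElem (by simp [hlen]) fun i _ _ => by simp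

theorem foldl_lie_eq (s : List L) (v : L) :
    s.foldl (fun u x => ⁅u, x⁆) v =
      (-1 : ℤ) ^ s.length • (s.reverse.map (LieAlgebra.ad F L)).prod v := by
  induction s using List.reverseRecOn with
  | nil => simp
  | append_singleton s x ih =>
    rw [List.foldl_append, ih, List.length_append, List.reverse_append, List.map_append,
      List.prod_append]
    simp only [List.foldl_cons, List.foldl_nil, List.length_singleton, List.reverse_singleton,
      List.map_singleton, List.prod_singleton, Module.End.mul_apply, LieAlgebra.ad_apply, pow_succ,
      mul_neg, mul_one, neg_smul]
    rw [← lie_skew, lie_zsmul]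

theorem exists_mem_multilinear_eval_eq [Fintype ι] [Fintype X] {ρ : H →ₐ[F] End F L}
    {f : (ι → L) → End F L} (e : ι ⊕ Unit ≃ X) (hf : f ∈ adPoly ρ univ.val) :
    ∃ p ∈ HPoly.multilinear F H X, ∀ a : X → L,
      HPoly.eval ρ a p = f (fun i => a (e (Sum.inl i))) (a (e (Sum.inr ()))) := by
  induction hf using Submodule.span_induction with
  | mem f hf =>
    obtain ⟨s, h₀, hs, rfl⟩ := hf
    let s' : List (X × H) :=
      (e (Sum.inr ()), h₀) :: (s.map fun p => (e (Sum.inl p.1), p.2)).reverse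
    have hs' : (s'.map Prod.fst : Multiset X) = univ.val := by
      have huniv : (univ : Finset (ι ⊕ Unit)).val = Sum.inr () ::ₘ univ.val.map Sum.inl :=
        add_comm _ {_}
      rw [← Multiset.map_univ_val_equiv e, huniv, ← hs]
      simp [s', Multiset.coe_reverse, comp_def, ← Multiset.cons_coe]
    refine ⟨(-1 : ℤ) ^ s.length • leftNormed (s'.map fun p => HPoly.var F p.1 p.2),
      zsmul_mem (HPoly.leftNormed_mem_multilinear s' hs') _, fun a => ?_⟩
    rw [map_zsmul, map_leftNormed, List.map_cons, List.map_cons, leftNormed, foldl_lie_eq (F := F),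
      smul_smul]
    simp [adWord, comp_def, HPoly.eval_var, ← mul_pow]
  | zero => exact ⟨0, zero_mem _, fun a => map_zero _⟩
  | add f g _ _ hf hg =>
    obtain ⟨p, hp, hpf⟩ := hf
    obtain ⟨q, hq, hqg⟩ := hg
    exact ⟨p + q, add_mem hp hq, fun a => by
      rw [map_add, hpf, hqg, Pi.add_apply, LinearMap.add_apply]⟩
  | smul c f _ hf =>
    obtain ⟨p, hp, hpf⟩ := hf
    exact ⟨c • p, Submodule.smul_mem _ c hp, fun a => by
      rw [map_smul, hpf, Pi.smul_apply, LinearMap.smul_apply]⟩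

end Polynomials

section Antisymmetrization

variable {F H L X G : Type*} [Field F] [Ring H] [Algebra F H] [LieRing L] [LieAlgebra F L]
  [Fintype X] [DecidableEq X] [Group G] [Fintype G]

theorem intCast_sign_mul_self (F : Type*) [Ring F] (σ : Perm X) :
    ((Perm.sign σ : ℤ) : F) * ((Perm.sign σ : ℤ) : F) = 1 := by
  rw [← Int.cast_mul, Int.units_coe_mul_self, Int.cast_one]

/-- The average of `sign (φ g) • rename (φ g) p` over a finite group `G` that permutes the
variables through `φ`. -/
noncomputable def HPoly.antisymmetrize (φ : G →* Perm X) (p : HPoly F H X) : HPoly F H X :=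
  (Fintype.card G : F)⁻¹ • ∑ g, ((Perm.sign (φ g) : ℤ) : F) • HPoly.rename (φ g) p

theorem HPoly.antisymmetrize_mem_multilinear (φ : G →* Perm X) {p : HPoly F H X}
    (hp : p ∈ HPoly.multilinear F H X) :
    HPoly.antisymmetrize φ p ∈ HPoly.multilinear F H X :=
  Submodule.smul_mem _ _ <| Submodule.sum_mem _ fun g _ =>
    Submodule.smul_mem _ _ (HPoly.rename_mem_multilinear (φ g) hp)

theorem HPoly.rename_antisymmetrize (φ : G →* Perm X) (p : HPoly F H X) (g : G) :
    HPoly.rename (φ g) (HPoly.antisymmetrize φ p) =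
      ((Perm.sign (φ g) : ℤ) : F) • HPoly.antisymmetrize φ p := by
  have hterm (g' : G) : HPoly.rename (φ g) (((Perm.sign (φ g') : ℤ) : F) • rename (φ g') p) =
      ((Perm.sign (φ g) : ℤ) : F) • ((Perm.sign (φ (g * g')) : ℤ) : F) • rename (φ (g * g')) p := by
    rw [map_smul, HPoly.rename_rename, smul_smul, map_mul, Perm.sign_mul, Units.val_mul,
      Int.cast_mul, ← mul_assoc, intCast_sign_mul_self, one_mul, Perm.coe_mul]
  rw [antisymmetrize, map_smul, map_sum, smul_comm]
  simp only [hterm, ← smul_sum]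
  exact congrArg _ <| congrArg _ <| Equiv.sum_comp (Equiv.mulLeft g) fun g' =>
    ((Perm.sign (φ g') : ℤ) : F) • rename (φ g') p

theorem HPoly.eval_antisymmetrize (hG : (Fintype.card G : F) ≠ 0) {ρ : H →ₐ[F] End F L}
    (φ : G →* Perm X) {p : HPoly F H X} {a : X → L}
    (hp : ∀ g, HPoly.eval ρ (a ∘ φ g) p = ((Perm.sign (φ g) : ℤ) : F) • HPoly.eval ρ a p) :
    HPoly.eval ρ a (HPoly.antisymmetrize φ p) = HPoly.eval ρ a p := by
  have hterm (g : G) : HPoly.eval ρ a (((Perm.sign (φ g) : ℤ) : F) • HPoly.rename (φ g) p) =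
      HPoly.eval ρ a p := by
    rw [map_smul, HPoly.eval_rename, hp, smul_smul, intCast_sign_mul_self, one_smul]
  rw [antisymmetrize, map_smul, map_sum]
  simp only [hterm, sum_const, card_univ]
  rw [← Nat.cast_smul_eq_nsmul F, inv_smul_smul₀ hG]

end Antisymmetrization

section Blocks

variable {t m C : ℕ}

/-- The permutation of the variables that permutes the `j`-th block by `τ j` and fixes the `z`'s. -/
def Var.blockPerm : (Fin m → Perm (Fin t)) →* Perm (Var t m C) where
  toFun τ := sumCongr (prodCongrRight τ) (Equiv.refl _)
  map_one' := by
    ext x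
    rcases x with ⟨j, i⟩ | x <;> rfl
  map_mul' τ τ' := by
    ext x
    rcases x with ⟨j, i⟩ | x <;> rfl

theorem Var.blockPerm_inl (τ : Fin m → Perm (Fin t)) (j : Fin m) (i : Fin t) :
    Var.blockPerm (C := C) τ (Sum.inl (j, i)) = Sum.inl (j, τ j i) :=
  rfl

theorem Var.blockPerm_inr (τ : Fin m → Perm (Fin t)) (z : Fin C ⊕ Unit) :
    Var.blockPerm τ (Sum.inr z) = Sum.inr z :=
  rfl

theorem Var.sign_blockPerm (τ : Fin m → Perm (Fin t)) :
    Perm.sign (Var.blockPerm (C := C) τ) = ∏ j, Perm.sign (τ j) := by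
  rw [← Perm.sign_prodCongrRight]
  refine (Perm.sign_sumCongr (prodCongrRight τ) 1).trans ?_
  rw [map_one, mul_one]

theorem Var.exists_blockPerm_eq {j : Fin m} {σ : Perm (Var t m C)}
    (hσ : ∀ x ∉ Var.block j, σ x = x) : ∃ τ, Var.blockPerm τ = σ := by
  have hinj : Injective fun i : Fin t => (Sum.inl (j, i) : Var t m C) := fun i i' h => by
    simpa using h
  let e : Fin t ≃ Var.block (t := t) (m := m) (C := C) j := Equiv.ofInjective _ hinj
  classical
  let σ' := (Perm.subtypeEquivSubtypePerm (· ∈ Var.block j)).symm ⟨σ, hσ⟩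
  refine ⟨Pi.mulSingle j (e.symm.permCongr σ'), Equiv.ext ?_⟩
  rintro (⟨j', i⟩ | z)
  · rw [Var.blockPerm_inl]
    obtain rfl | hj := eq_or_ne j' j
    · rw [Pi.mulSingle_eq_same]
      exact congrArg Subtype.val (e.apply_symm_apply (σ' (e i)))
    · rw [Pi.mulSingle_eq_of_ne hj]
      exact (hσ _ (by simp [Var.block, hj.symm])).symm
  · rw [Var.blockPerm_inr, hσ _ (by simp [Var.block])]

theorem Var.isAlternatingIn_block {F H : Type*} [Field F] [Ring H] [Algebra F H]
    {f : HPoly F H (Var t m C)}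
    (hf : ∀ τ : Fin m → Perm (Fin t), HPoly.rename (Var.blockPerm τ) f =
      ((Perm.sign (Var.blockPerm (C := C) τ) : ℤ) : F) • f) (j : Fin m) :
    f.IsAlternatingIn (Var.block j) := by
  intro σ hσ
  obtain ⟨τ, rfl⟩ := Var.exists_blockPerm_eq hσ
  exact hf τ

end Blocks

end HLie

open HLie Function Equiv in
theorem mainTheorem5_general {F H L : Type*} [Field F] [Ring H] [Algebra F H]
    [LieRing L] [LieAlgebra F L] [LieAlgebra.IsKilling F L]
    (ρ : H →ₐ[F] Module.End F L) (hρ : IsGeneralizedAction ρ)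
    (hsimple : IsHSimple ρ) (hcentral : IsHCentral ρ)
    {t : ℕ} (ht : (t.factorial : F) ≠ 0) (l : Module.Basis (Fin t) F L) :
    ∃ (C : ℕ) (w : Fin C → L), 0 < C ∧
      ∀ k : ℕ, ∃ f : HPoly F H (Var t (2 * k) C),
        f ∈ HPoly.multilinear F H (Var t (2 * k) C) ∧
        (∀ j : Fin (2 * k), f.IsAlternatingIn (Var.block j)) ∧
        ∀ v : L, HPoly.eval ρ (Var.subst l w v) f = v := by
  obtain ⟨C, w, g, hC, hgw, hg⟩ := exists_prod_det_smul_mem_adPoly l hρ hsimple hcentral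
  refine ⟨C, w, hC, fun k => ?_⟩
  obtain ⟨p, hp, hpeval⟩ := exists_mem_multilinear_eval_eq (Equiv.sumAssoc _ _ Unit) (hg k)
  have hvalue (τ : Fin (2 * k) → Perm (Fin t)) (v : L) :
      HPoly.eval ρ (Var.subst l w v ∘ Var.blockPerm τ) p =
        ((Perm.sign (Var.blockPerm (C := C) τ) : ℤ) : F) • v := by
    have hdet (j) : l.det (fun i => l (τ j i)) = ((Perm.sign (τ j) : ℤ) : F) := by
      rw [← comp_def, l.det.map_perm, l.det_self, Units.smul_def, zsmul_one]
    simp [hpeval, Var.sign_blockPerm, Var.subst, hgw, Var.blockPerm_inl, Var.blockPerm_inr, hdet,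
      comp_def]
  refine ⟨HPoly.antisymmetrize Var.blockPerm p, HPoly.antisymmetrize_mem_multilinear _ hp,
    Var.isAlternatingIn_block (HPoly.rename_antisymmetrize _ p), fun v => ?_⟩
  have hp_eval : HPoly.eval ρ (Var.subst l w v) p = v := by simpa using hvalue 1 v
  rw [HPoly.eval_antisymmetrize (by simp [Fintype.card_perm, ht]) _ fun τ => by
    rw [hvalue, hp_eval], hp_eval]

theorem mainTheorem5 {F H L : Type*} [Field F] [CharZero F]
    [Ring H] [Algebra F H] [FiniteDimensional F H]
    [LieRing L] [LieAlgebra F L] [FiniteDimensional F L] [LieAlgebra.IsSemisimple F L]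
    (ρ : H →ₐ[F] Module.End F L) (hρ : HLie.IsGeneralizedAction ρ)
    (hsimple : HLie.IsHSimple ρ)
    (hcentral : IsAlgClosed F ∨ HLie.IsHCentral ρ)
    {t : ℕ} (l : Module.Basis (Fin t) F L) :
    ∃ (C : ℕ) (w : Fin C → L), 0 < C ∧
      ∀ k : ℕ, ∃ f : HLie.HPoly F H (HLie.Var t (2 * k) C),
        f ∈ HLie.HPoly.multilinear F H (HLie.Var t (2 * k) C) ∧
        (∀ j : Fin (2 * k), f.IsAlternatingIn (HLie.Var.block j)) ∧
        ∀ v : L, HLie.HPoly.eval ρ (HLie.Var.subst l w v) f = v :=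
  mainTheorem5_general ρ hρ hsimple (hcentral.elim (fun _ => hsimple.isHCentral) id)
    (Nat.cast_ne_zero.2 t.factorial_ne_zero) l
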